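/- **Setting.** Consider the impulsive system with inputs $$\dot x(t)=f(t,x(t),u(t))\ \ (t\notin\gamma),\qquad x(t)=x(t^-)+g(t,x(t^-),u(t))\ \ (t\in\gamma),\qquad t\ge 0,$$ with $f,g:\mathbb R_{\ge0}\times\mathbb R^n\times\mathbb R^m\to\mathbb R^n$. An input is a Lebesgue measurable, locally essentially bounded function $u:[0,\infty)\to\mathbb R^m$, and for every input $u$ the map $(t,\xi)\mapsto f(t,\xi,u(t))$ is assumed to be a Carathéodory function. $\Gamma$ denotes the set of all finite or infinite strictly increasing sequences $\gamma=\{\tau_k\}\subset(0,\infty)$ without finite limit points, and $n^\gamma_{(s,t]}$ is the number of elements of $\gamma$ in $(s,t]$. Put $\tau_0=0$ and, if $\gamma$ has $N<\infty$ elements, $\tau_{N+1}=\infty$. A solution with initial time $t_0\ge0$, initial state $x_0$, input $u$ and sequence $\gamma$ is a function $x:[t_0,T_x)\to\mathbb R^n$, $t_0<T_x\le\infty$, with $x(t_0)=x_0$, that is locally absolutely continuous with $\dot x(t)=f(t,x(t),u(t))$ a.e. on each nonempty interval $[\tau_k,\tau_{k+1})\cap[t_0,T_x)$, and such that for each $\tau\in\gamma\cap(t_0,T_x)$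 the left limit $x(\tau^-)$ exists and is finite and $x(\tau)=x(\tau^-)+g(\tau,x(\tau^-),u(\tau))$. It is maximal if no solution with the same data and a larger interval of definition extends it. A function $\mathbb R_{\ge0}\to\mathbb R_{\ge0}$ that is continuous and vanishes at $0$ is in $\mathcal P$ if it is positive on $(0,\infty)$, in $\mathcal K$ if it is strictly increasing, and in $\mathcal K_\infty$ if it is in $\mathcal K$ and unbounded. A continuous $\beta:\mathbb R_{\ge0}^2\to\mathbb R_{\ge0}$ is in $\mathcal{KL}$ if $\beta(\cdot,t)\in\mathcal K$ for all $t\ge0$, $\beta(r,\cdot)$ is strictly decreasing whenever positive, and $\lim_{t\to\infty}\beta(r,t)=0$ for all $r\ge0$. For $I\subset\mathbb R_{\ge 0}$ let $\|u_I\|_\gamma=\max\{\operatorname{ess\,sup}_{t\in I}|u(t)|,\ \sup_{t\in\gamma\cap I}|u(t)|\}$. Let $h^o,h:\mathbb R_{\ge0}\times\mathbb R^n\to\mathbb R_{\ge0}$ and $\mathcal S\subset\Gamma$. The system is *strongly $(h^o,h)$-ISS over $\mathcal S$* if there are $\beta\in\mathcal{KL}$ and $\rho\in\mathcal K_\infty$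 such that for all $t_0\ge0$, $x_0\in\mathbb R^n$, inputs $u$, $\gamma\in\mathcal S$ and maximal solutions $x$ with these data, $$h(t,x(t))\le\beta\big(h^o(t_0,x_0),\,t-t_0+n^\gamma_{(t_0,t]}\big)+\rho\big(\|u_{(t_0,t]}\|_\gamma\big)\qquad\text{for all }t\in[t_0,T_x).$$ A locally Lipschitz $V:\mathbb R_{\ge0}\times\mathbb R^n\to\mathbb R$ is an *$(h^o,h)$-ISS Lyapunov function candidate* with rate functions $p,\varphi,\psi$ if $p:\mathbb R_{\ge0}\to\mathbb R_{\ge0}$ is locally integrable, $\varphi:\mathbb R_{\ge0}\to\mathbb R$ is continuous, $\psi\in\mathcal P$, there are $\phi_1,\phi_2\in\mathcal K_\infty$ with $\phi_1(h(t,\xi))\le V(t,\xi)\le\phi_2(h^o(t,\xi))$ for all $t\ge 0$, $\xi\in\mathbb R^n$, and there are $\chi,\pi\in\mathcal K_\infty$ such that for all $t\ge0$, $\xi\in\mathbb R^n$, $\mu\in\mathbb R^m$: * if $V(t,\xi)\ge\chi(|\mu|)$, then $\displaystyle\limsup_{s\to0^+}\frac{V(t+s,\xi+s f(t,\xi,\mu))-V(t,\xi)}{s}\le-p(t)\varphi(V(t,\xi))$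 and $V(t,\xi+g(t,\xi,\mu))\le\psi(V(t,\xi))$; * if $V(t,\xi)\le\chi(|\mu|)$, then $V(t,\xi+g(t,\xi,\mu))\le\pi(|\mu|)$. For $\rho\ge0$, $\check{\mathcal S}(\rho)$ is the set of all $\gamma\in\Gamma$ such that for every $\varepsilon>0$ there is $T>0$ with $n^\gamma_{(s,s+t]}/t\ge\rho-\varepsilon$ for all $t\ge T$ and $s\ge0$. A set $\mathcal S\subset\check{\mathcal S}(\rho)$ is a *uniform subset* of $\check{\mathcal S}(\rho)$ if $T$ can be chosen independently of $\gamma\in\mathcal S$. **Theorem.** Let $V$ be an $(h^o,h)$-ISS Lyapunov function candidate for the system, with rate functions $p,\varphi,\psi$ such that $\psi,-\varphi\in\mathcal P$. Let $\theta>0$ be such that $$\inf_{a>0}\int_{\psi(a)}^a\frac{ds}{-\varphi(s)}>\sup_{t\ge0}\int_t^{t+\theta}p(s)\,ds,$$ and suppose that $\int_1^\infty\frac{ds}{-\varphi(s)}=\infty$. Then the system is strongly $(h^o,h)$-ISS over every uniform subset $\mathcal S$ of $\check{\mathcal S}(1/\theta)$. -/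

import Mathlib

open MeasureTheory Filter Topology Set

namespace ImpulsiveISS

/-! ### Comparison functions

Functions on `[0, ∞)` are represented by functions on `ℝ` of which only the values on `Ici 0`
are constrained and used. -/

/-- Class `C_*`: continuous functions `[0, ∞) → [0, ∞)` that vanish at `0`. -/
structure ClassCStar (φ : ℝ → ℝ) : Prop where
  continuousOn : ContinuousOn φ (Ici 0)
  nonneg : ∀ s, 0 ≤ s → 0 ≤ φ s
  map_zero : φ 0 = 0

/-- Class `P`: positive definite functions. -/
structure ClassP (φ : ℝ → ℝ) : Prop extends ClassCStar φ where
  pos : ∀ s, 0 < s → 0 < φ s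

/-- Class `K`: strictly increasing functions of class `C_*`. -/
structure ClassK (φ : ℝ → ℝ) : Prop extends ClassCStar φ where
  strictMonoOn : StrictMonoOn φ (Ici 0)

/-- Class `K_∞`: unbounded functions of class `K`. -/
structure ClassKInf (φ : ℝ → ℝ) : Prop extends ClassK φ where
  unbounded : ∀ M : ℝ, ∃ s, 0 ≤ s ∧ M < φ s

/-- Class `KL`: continuous `β : [0, ∞) × [0, ∞) → [0, ∞)` with `β(·, t) ∈ K` for each `t ≥ 0`,
`β(r, ·)` strictly decreasing whenever positive, and `β(r, t) → 0` as `t → ∞`. -/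
structure ClassKL (β : ℝ → ℝ → ℝ) : Prop where
  continuousOn : ContinuousOn (fun q : ℝ × ℝ => β q.1 q.2) (Ici 0 ×ˢ Ici 0)
  classK : ∀ t, 0 ≤ t → ClassK (fun r => β r t)
  strictAnti : ∀ r, 0 ≤ r → ∀ s t, 0 ≤ s → s < t → 0 < β r s → β r t < β r s
  tendsto_zero : ∀ r, 0 ≤ r → Tendsto (β r) atTop (𝓝 0)

/-! ### Impulse-time sequences -/

/-- Impulse-time sequences. A finite or infinite strictly increasing sequence in `(0, ∞)` without
finite limit points is identified with the set of its values: these sets are exactly the subsets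
of `(0, ∞)` with finitely many elements in each bounded interval. -/
def ImpulseTimes : Set (Set ℝ) :=
  {γ | γ ⊆ Ioi 0 ∧ ∀ b : ℝ, (γ ∩ Iic b).Finite}

/-- The number of impulse times in `(s, t]`. -/
noncomputable def numImpulses (γ : Set ℝ) (s t : ℝ) : ℕ := (γ ∩ Ioc s t).ncard

/-- The impulse-time sequences whose impulse frequency is eventually uniformly bounded below
by `ρ`. -/
def EvUnifLowerBdd (ρ : ℝ) : Set (Set ℝ) :=
  {γ | γ ∈ ImpulseTimes ∧ ∀ ε : ℝ, 0 < ε → ∃ T : ℝ, 0 < T ∧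
    ∀ t, T ≤ t → ∀ s, 0 ≤ s → ρ - ε ≤ (numImpulses γ s (s + t) : ℝ) / t}

/-- `S` is a uniform subset of `EvUnifLowerBdd ρ`: a subset for which the time `T` can be chosen
independently of the sequence. -/
def IsUniformSubset (S : Set (Set ℝ)) (ρ : ℝ) : Prop :=
  S ⊆ EvUnifLowerBdd ρ ∧ ∀ ε : ℝ, 0 < ε → ∃ T : ℝ, 0 < T ∧
    ∀ γ ∈ S, ∀ t, T ≤ t → ∀ s, 0 ≤ s → ρ - ε ≤ (numImpulses γ s (s + t) : ℝ) / t

section System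

variable {n m : ℕ}

/-! ### Inputs -/

/-- Inputs: Lebesgue measurable, locally essentially bounded functions `[0, ∞) → ℝᵐ`. -/
def Inputs (m : ℕ) : Set (ℝ → EuclideanSpace ℝ (Fin m)) :=
  {u | AEMeasurable u (volume.restrict (Ici 0)) ∧
    ∀ b : ℝ, ∃ C : ℝ, ∀ᵐ t ∂(volume.restrict (Icc 0 b)), ‖u t‖ ≤ C}

/-- `‖u_I‖_γ`, the maximum of the essential supremum of `|u|` over `I` and of the supremum of
`|u|` over `γ ∩ I`, with values in `[0, ∞]` (both suprema are `0` if `I` is empty; the value is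
finite if `u` is an input, `γ` an impulse-time sequence and `I ⊆ [0, ∞)` is bounded). -/
noncomputable def inputNorm (γ : Set ℝ) (u : ℝ → EuclideanSpace ℝ (Fin m)) (I : Set ℝ) : ENNReal :=
  max (essSup (fun t => ‖u t‖ₑ) (volume.restrict I)) (⨆ t ∈ γ ∩ I, ‖u t‖ₑ)

/-! ### The impulsive system

`ẋ(t) = f(t, x(t), u(t))` for `t ∉ γ`, `x(t) = x(t⁻) + g(t, x(t⁻), u(t))` for `t ∈ γ`. -/

/-- Carathéodory functions on `[0, ∞) × ℝⁿ`: measurable in time, continuous in the state, and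
dominated on each compact set by an integrable function of time. -/
structure IsCaratheodory
    (F : ℝ → EuclideanSpace ℝ (Fin n) → EuclideanSpace ℝ (Fin n)) : Prop where
  aemeasurable : ∀ ξ, AEMeasurable (fun t => F t ξ) (volume.restrict (Ici 0))
  continuous : ∀ t, 0 ≤ t → Continuous (F t)
  dominated : ∀ K : Set (ℝ × EuclideanSpace ℝ (Fin n)), K ⊆ Ici 0 ×ˢ univ → IsCompact K →
    ∃ b : ℝ → ℝ, Integrable b ∧ ∀ q ∈ K, ‖F q.1 q.2‖ ≤ b q.1

/-- `x` is a solution on `[t₀, T)`, where `t₀ < T ≤ ∞`. Only the values of `x` on `[t₀, T)`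
matter. A compact interval `[a, b] ⊆ [t₀, T)` lies in some `[τ_k, τ_{k+1})` exactly if `(a, b]`
contains no impulse time, so `absCont` is local absolute continuity on each interval
`[τ_k, τ_{k+1}) ∩ [t₀, T)`; the impulse times form a null set. -/
structure IsSolution
    (f g : ℝ → EuclideanSpace ℝ (Fin n) → EuclideanSpace ℝ (Fin m) → EuclideanSpace ℝ (Fin n))
    (t₀ : ℝ) (x₀ : EuclideanSpace ℝ (Fin n)) (u : ℝ → EuclideanSpace ℝ (Fin m)) (γ : Set ℝ)
    (T : EReal) (x : ℝ → EuclideanSpace ℝ (Fin n)) : Prop where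
  lt : (t₀ : EReal) < T
  init : x t₀ = x₀
  absCont : ∀ a b : ℝ, t₀ ≤ a → a ≤ b → (b : EReal) < T → γ ∩ Ioc a b = ∅ →
    AbsolutelyContinuousOnInterval x a b
  flow : ∀ᵐ t : ℝ, t₀ < t → (t : EReal) < T → HasDerivAt x (f t (x t) (u t)) t
  jump : ∀ τ ∈ γ, t₀ < τ → (τ : EReal) < T →
    ∃ y, Tendsto x (𝓝[<] τ) (𝓝 y) ∧ x τ = y + g τ y (u τ)

/-- `x` is a maximally defined solution, with interval of definition `[t₀, T)`. -/
def IsMaximalSolution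
    (f g : ℝ → EuclideanSpace ℝ (Fin n) → EuclideanSpace ℝ (Fin m) → EuclideanSpace ℝ (Fin n))
    (t₀ : ℝ) (x₀ : EuclideanSpace ℝ (Fin n)) (u : ℝ → EuclideanSpace ℝ (Fin m)) (γ : Set ℝ)
    (T : EReal) (x : ℝ → EuclideanSpace ℝ (Fin n)) : Prop :=
  IsSolution f g t₀ x₀ u γ T x ∧
    ¬ ∃ (T' : EReal) (y : ℝ → EuclideanSpace ℝ (Fin n)), T < T' ∧
      IsSolution f g t₀ x₀ u γ T' y ∧ ∀ t : ℝ, t₀ ≤ t → (t : EReal) < T → y t = x t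

/-- Strong `(hᵒ, h)`-input-to-state stability over the class `S` of impulse-time sequences. -/
def StronglyISS
    (f g : ℝ → EuclideanSpace ℝ (Fin n) → EuclideanSpace ℝ (Fin m) → EuclideanSpace ℝ (Fin n))
    (hO h : ℝ → EuclideanSpace ℝ (Fin n) → ℝ) (S : Set (Set ℝ)) : Prop :=
  ∃ (β : ℝ → ℝ → ℝ) (ρ : ℝ → ℝ), ClassKL β ∧ ClassKInf ρ ∧
    ∀ (t₀ : ℝ), 0 ≤ t₀ → ∀ (x₀ : EuclideanSpace ℝ (Fin n)), ∀ u ∈ Inputs m, ∀ γ ∈ S,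
      ∀ (T : EReal) (x : ℝ → EuclideanSpace ℝ (Fin n)), IsMaximalSolution f g t₀ x₀ u γ T x →
        ∀ t : ℝ, t₀ ≤ t → (t : EReal) < T →
          h t (x t) ≤ β (hO t₀ x₀) (t - t₀ + (numImpulses γ t₀ t : ℝ))
            + ρ (inputNorm γ u (Ioc t₀ t)).toReal

/-! ### Lyapunov function candidates -/

/-- The upper-right Dini derivative of `V` along `f` at `(t, ξ, μ)`. -/
noncomputable def diniDeriv
    (f : ℝ → EuclideanSpace ℝ (Fin n) → EuclideanSpace ℝ (Fin m) → EuclideanSpace ℝ (Fin n))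
    (V : ℝ → EuclideanSpace ℝ (Fin n) → ℝ)
    (t : ℝ) (ξ : EuclideanSpace ℝ (Fin n)) (μ : EuclideanSpace ℝ (Fin m)) : EReal :=
  limsup (fun s : ℝ => (((V (t + s) (ξ + s • f t ξ μ) - V t ξ) / s : ℝ) : EReal)) (𝓝[>] 0)

/-- `V` is an `(hᵒ, h)`-ISS Lyapunov function candidate with rate functions `p`, `φ` and `ψ`. -/
structure IsLyapunovCandidate
    (f g : ℝ → EuclideanSpace ℝ (Fin n) → EuclideanSpace ℝ (Fin m) → EuclideanSpace ℝ (Fin n))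
    (hO h V : ℝ → EuclideanSpace ℝ (Fin n) → ℝ) (p φ ψ : ℝ → ℝ) : Prop where
  locallyLipschitz :
    LocallyLipschitzOn (Ici 0 ×ˢ univ) (fun q : ℝ × EuclideanSpace ℝ (Fin n) => V q.1 q.2)
  sandwich : ∃ φ₁ φ₂ : ℝ → ℝ, ClassKInf φ₁ ∧ ClassKInf φ₂ ∧
    ∀ t, 0 ≤ t → ∀ ξ, φ₁ (h t ξ) ≤ V t ξ ∧ V t ξ ≤ φ₂ (hO t ξ)
  p_locallyIntegrable : LocallyIntegrableOn p (Ici 0)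
  p_nonneg : ∀ t, 0 ≤ t → 0 ≤ p t
  φ_continuousOn : ContinuousOn φ (Ici 0)
  ψ_classP : ClassP ψ
  decay : ∃ χ π : ℝ → ℝ, ClassKInf χ ∧ ClassKInf π ∧
    ∀ (t : ℝ), 0 ≤ t → ∀ (ξ : EuclideanSpace ℝ (Fin n)) (μ : EuclideanSpace ℝ (Fin m)),
      (χ ‖μ‖ ≤ V t ξ → diniDeriv f V t ξ μ ≤ ((-p t * φ (V t ξ) : ℝ) : EReal)) ∧
      (χ ‖μ‖ ≤ V t ξ → V t (ξ + g t ξ μ) ≤ ψ (V t ξ)) ∧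
      (V t ξ ≤ χ ‖μ‖ → V t (ξ + g t ξ μ) ≤ π ‖μ‖)

end System

end ImpulsiveISS

namespace ImpulsiveISS

/-! ### Comparison functions -/

/-! Put `α = -φ` and let `F` be an antiderivative of `1 / α` on `(0, ∞)`. In the coordinate `F(V)`
the dynamics become additive: without input, the flow raises `F(V)` at rate at most `p`, and each
impulse lowers it by at least `M`, a number strictly between the supremum of the window integrals of
`p` and the infimum of the gap integrals. `F` maps onto `ℝ`: it is unbounded above by the divergence
of the integral, and unbounded below because iterating `ψ` lowers it by `M` each time
(`exists_isRectification`). Hence it has an inverse `E` on all of `ℝ`.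

Over a uniform subset, impulses come at asymptotic rate at least `1 / θ`, so the accumulated change
`∫ p - M n` is at most `C - c (elapsed time + n)` with uniform constants
(`IsUniformSubset.exists_linear_decay`).

The input is handled by a cutoff: with `R` above both gains of the input bound, follow `F(max V R)`.
Below `R` this is constant and minimal. Above `R` the flow estimate applies, and an impulse either
lowers the quantity by `M` or lands at the floor `F R` (`rectified_flow_le`, `rectified_jump_le`).
Induction on the number of impulses (`impulsive_comparison`) bounds it by its initial value, or by
the floor at some later reset time, plus the accumulated change since then. Applying `E` turns the
first alternative into the `KL` term and the second into the input gain. -/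

lemma ClassK.monotoneOn {φ : ℝ → ℝ} (h : ClassK φ) : MonotoneOn φ (Ici 0) :=
  h.strictMonoOn.monotoneOn

lemma ClassK.pos {φ : ℝ → ℝ} (h : ClassK φ) {s : ℝ} (hs : 0 < s) : 0 < φ s := by
  simpa [h.map_zero] using h.strictMonoOn self_mem_Ici hs.le hs

lemma ClassK.comp {φ₁ φ₂ : ℝ → ℝ} (h₁ : ClassK φ₁) (h₂ : ClassK φ₂) :
    ClassK (fun s => φ₁ (φ₂ s)) where
  continuousOn := h₁.continuousOn.comp h₂.continuousOn h₂.nonneg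
  nonneg s hs := h₁.nonneg _ (h₂.nonneg s hs)
  map_zero := by rw [h₂.map_zero, h₁.map_zero]
  strictMonoOn := h₁.strictMonoOn.comp h₂.strictMonoOn h₂.nonneg

lemma ClassKInf.comp {φ₁ φ₂ : ℝ → ℝ} (h₁ : ClassKInf φ₁) (h₂ : ClassKInf φ₂) :
    ClassKInf (fun s => φ₁ (φ₂ s)) where
  toClassK := h₁.toClassK.comp h₂.toClassK
  unbounded M := by
    obtain ⟨r, hr, hM⟩ := h₁.unbounded M
    obtain ⟨s, hs, hrs⟩ := h₂.unbounded r
    exact ⟨s, hs, hM.trans (h₁.strictMonoOn hr (h₂.nonneg s hs) hrs)⟩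

lemma ClassKInf.add {φ₁ φ₂ : ℝ → ℝ} (h₁ : ClassKInf φ₁) (h₂ : ClassKInf φ₂) :
    ClassKInf (fun s => φ₁ s + φ₂ s) where
  continuousOn := h₁.continuousOn.add h₂.continuousOn
  nonneg s hs := add_nonneg (h₁.nonneg s hs) (h₂.nonneg s hs)
  map_zero := by rw [h₁.map_zero, h₂.map_zero, add_zero]
  strictMonoOn := h₁.strictMonoOn.add h₂.strictMonoOn
  unbounded M := by
    obtain ⟨s, hs, hM⟩ := h₁.unbounded M
    exact ⟨s, hs, by linarith [h₂.nonneg s hs]⟩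

/-- Continued by the identity on the negative half-line, `φ` becomes an increasing continuous
bijection of `ℝ`, hence an order isomorphism, and its inverse is automatically continuous. -/
lemma ClassKInf.exists_inverse {φ : ℝ → ℝ} (h : ClassKInf φ) :
    ∃ η : ℝ → ℝ, ClassKInf η ∧ ∀ s, 0 ≤ s → η (φ s) = s := by
  set e : ℝ → ℝ := fun x => φ (max x 0) + min x 0 with he
  have hcont : Continuous e :=
    (h.continuousOn.comp_continuous (by fun_prop) fun x => le_max_right x 0).add (by fun_prop)
  have hpos : ∀ x, 0 ≤ x → e x = φ x := fun x hx => by simp [he, hx]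
  have hneg : ∀ x, x ≤ 0 → e x = x := fun x hx => by simp [he, hx, h.map_zero]
  have hmono : StrictMono e := by
    intro x y hxy
    rcases le_or_gt 0 x with hx | hx
    · rw [hpos x hx, hpos y (hx.trans hxy.le)]
      exact h.strictMonoOn hx (hx.trans hxy.le) hxy
    · rw [hneg x hx.le]
      rcases le_or_gt 0 y with hy | hy
      · rw [hpos y hy]
        exact hx.trans_le (h.nonneg y hy)
      · rwa [hneg y hy.le]
  have hsurj : Function.Surjective e := fun z =>
    mem_range_of_exists_le_of_exists_ge hcont
      ⟨min z 0, by rw [hneg _ (min_le_right _ _)]; exact min_le_left _ _⟩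
      (by obtain ⟨s, hs, hz⟩ := h.unbounded z
          exact ⟨s, by rw [hpos s hs]; exact hz.le⟩)
  set i : ℝ ≃o ℝ := hmono.orderIsoOfSurjective e hsurj with hi
  have hie : ∀ x, i.symm (e x) = x := fun x => i.symm_apply_apply x
  have hφ : ∀ s, 0 ≤ s → i.symm (φ s) = s := fun s hs => by rw [← hpos s hs, hie]
  have h0 : i.symm 0 = 0 := by simpa [h.map_zero] using hφ 0 le_rfl
  refine ⟨i.symm, ⟨⟨⟨i.symm.continuous.continuousOn, fun s hs => ?_, h0⟩,
    i.symm.strictMono.strictMonoOn _⟩, fun M => ?_⟩, hφ⟩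
  · rw [← h0]
    exact i.symm.monotone hs
  · refine ⟨φ (max M 0 + 1), h.nonneg _ (by positivity), ?_⟩
    rw [hφ _ (by positivity)]
    linarith [le_max_left M 0]

/-! ### Rectification of `v' = α(v)` -/

/-- `F` is an antiderivative of `1 / α` on `(0, ∞)`, and `E : ℝ → (0, ∞)` is its inverse. -/
structure IsRectification (α F E : ℝ → ℝ) : Prop where
  hasDerivAt : ∀ y, 0 < y → HasDerivAt F (1 / α y) y
  strictMonoOn : StrictMonoOn F (Ioi 0)
  integral_eq : ∀ a b, 0 < a → 0 < b → ∫ s in a..b, 1 / α s = F b - F a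
  continuous_inv : Continuous E
  strictMono_inv : StrictMono E
  inv_pos : ∀ z, 0 < E z
  left_inv : ∀ y, 0 < y → E (F y) = y
  right_inv : ∀ z, F (E z) = z

/-- The gap condition says `F (ψ a) ≤ F a - M`, so the iterates of `ψ` from `1` drive `F` to `-∞`.
If `F` were bounded above, `1 / α` would be integrable on `(1, ∞)`. -/
lemma exists_isRectification {α ψ : ℝ → ℝ} (hα : ClassP α) (hψ : ∀ a, 0 < a → 0 < ψ a)
    {M : ℝ} (hM : 0 < M) (hgap : ∀ a, 0 < a → M ≤ ∫ s in (ψ a)..a, 1 / α s)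
    (hdiv : ∫⁻ s in Ioi (1 : ℝ), ENNReal.ofReal (1 / α s) = ⊤) :
    ∃ F E, IsRectification α F E := by
  have hc : ContinuousOn (fun s => 1 / α s) (Ioi 0) :=
    continuousOn_const.div (hα.continuousOn.mono Ioi_subset_Ici_self) fun s hs => (hα.pos s hs).ne'
  have hint : ∀ a b, 0 < a → 0 < b → IntervalIntegrable (fun s => 1 / α s) volume a b :=
    fun a b ha hb => (hc.mono fun s hs => lt_of_lt_of_le (lt_min ha hb) hs.1).intervalIntegrable
  set F : ℝ → ℝ := fun y => ∫ s in (1 : ℝ)..y, 1 / α s with hF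
  have hderiv : ∀ y, 0 < y → HasDerivAt F (1 / α y) y := fun y hy =>
    intervalIntegral.integral_hasDerivAt_right (hint 1 y one_pos hy)
      (hc.stronglyMeasurableAtFilter isOpen_Ioi y hy) (hc.continuousAt (Ioi_mem_nhds hy))
  have hFc : ContinuousOn F (Ioi 0) := fun y hy => (hderiv y hy).continuousAt.continuousWithinAt
  have hmono : StrictMonoOn F (Ioi 0) := by
    refine strictMonoOn_of_deriv_pos (convex_Ioi 0) hFc fun y hy => ?_
    rw [interior_Ioi] at hy
    rw [(hderiv y hy).deriv]
    exact one_div_pos.2 (hα.pos y hy)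
  have hsub : ∀ a b, 0 < a → 0 < b → ∫ s in a..b, 1 / α s = F b - F a := fun a b ha hb =>
    (intervalIntegral.integral_interval_sub_left (hint 1 b one_pos hb)
      (hint 1 a one_pos ha)).symm
  have hbot : ∀ z, ∃ y, 0 < y ∧ F y ≤ z := by
    have hiter : ∀ k : ℕ, ∃ y, 0 < y ∧ F y ≤ -(k * M) := by
      intro k
      induction k with
      | zero => exact ⟨1, one_pos, by simp [hF]⟩
      | succ k ih =>
        obtain ⟨y, hy, hFy⟩ := ih
        refine ⟨ψ y, hψ y hy, ?_⟩
        have := hgap y hy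
        rw [hsub _ _ (hψ y hy) hy] at this
        push_cast
        linarith
    intro z
    obtain ⟨k, hk⟩ := exists_nat_gt (-z / M)
    obtain ⟨y, hy, hFy⟩ := hiter k
    rw [div_lt_iff₀ hM] at hk
    exact ⟨y, hy, by linarith⟩
  have htop : ∀ z, ∃ y, 0 < y ∧ z ≤ F y := by
    by_contra! hcon
    obtain ⟨z, hz⟩ := hcon
    have hI : IntegrableOn (fun s => 1 / α s) (Ioi 1) := by
      refine integrableOn_Ioi_of_intervalIntegral_norm_bounded z 1 (l := atTop) (b := id)
        (fun b => ?_) tendsto_id ?_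
      · rcases le_or_gt 1 b with hb | hb
        · exact (intervalIntegrable_iff_integrableOn_Ioc_of_le hb).1
            (hint 1 b one_pos (one_pos.trans_le hb))
        · simp [Ioc_eq_empty_of_le hb.le]
      · filter_upwards [eventually_ge_atTop 1] with b hb
        have hb0 : 0 < b := one_pos.trans_le hb
        refine le_trans (le_of_eq ?_) (hz b hb0).le
        refine intervalIntegral.integral_congr fun s hs => ?_
        rw [id, uIcc_of_le hb] at hs
        exact Real.norm_of_nonneg (one_div_pos.2 (hα.pos s (one_pos.trans_le hs.1))).le
    have := hI.lintegral_lt_top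
    exact absurd hdiv this.ne
  -- Precomposing with `exp` moves the domain `(0, ∞)` to `ℝ`, where a monotone surjection gives an
  -- order isomorphism.
  have hGc : Continuous fun x => F (Real.exp x) :=
    hFc.comp_continuous Real.continuous_exp fun x => Real.exp_pos x
  have hGm : StrictMono fun x => F (Real.exp x) := fun x y hxy =>
    hmono (Real.exp_pos x) (Real.exp_pos y) (Real.exp_lt_exp.2 hxy)
  have hGs : Function.Surjective fun x => F (Real.exp x) := fun z =>
    mem_range_of_exists_le_of_exists_ge hGc
      (by obtain ⟨y, hy, h⟩ := hbot z
          exact ⟨Real.log y, by rwa [Real.exp_log hy]⟩)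
      (by obtain ⟨y, hy, h⟩ := htop z
          exact ⟨Real.log y, by rwa [Real.exp_log hy]⟩)
  set i : ℝ ≃o ℝ := hGm.orderIsoOfSurjective _ hGs with hi
  refine ⟨F, fun z => Real.exp (i.symm z), hderiv, hmono, hsub,
    Real.continuous_exp.comp i.symm.continuous, Real.exp_strictMono.comp i.symm.strictMono,
    fun z => Real.exp_pos _, fun y hy => ?_, fun z => i.apply_symm_apply z⟩
  have : i.symm (F (Real.exp (Real.log y))) = Real.log y := i.symm_apply_apply _
  rw [Real.exp_log hy] at this
  simp only [this, Real.exp_log hy]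

/-- The flow of `v' = α(v)` on `[0, ∞)` for the (possibly negative) time `z`, in terms of a
rectification. -/
noncomputable def rectFlow (F E : ℝ → ℝ) (v z : ℝ) : ℝ := if v ≤ 0 then 0 else E (F v + z)

namespace IsRectification

variable {α F E : ℝ → ℝ}

lemma le_inv_of_le (h : IsRectification α F E) {y z : ℝ} (hy : 0 < y) (hyz : F y ≤ z) :
    y ≤ E z := by
  simpa [h.left_inv y hy] using h.strictMono_inv.monotone hyz

lemma rectFlow_of_pos (_ : IsRectification α F E) {v : ℝ} (hv : 0 < v) (z : ℝ) :
    rectFlow F E v z = E (F v + z) := if_neg hv.not_ge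

lemma rectFlow_pos (h : IsRectification α F E) {v : ℝ} (hv : 0 < v) (z : ℝ) :
    0 < rectFlow F E v z := by
  rw [h.rectFlow_of_pos hv]; exact h.inv_pos _

lemma rectFlow_nonneg (h : IsRectification α F E) (v z : ℝ) : 0 ≤ rectFlow F E v z := by
  rcases le_or_gt v 0 with hv | hv
  · simp [rectFlow, hv]
  · exact (h.rectFlow_pos hv z).le

lemma strictMonoOn_rectFlow (h : IsRectification α F E) (z : ℝ) :
    StrictMonoOn (fun v => rectFlow F E v z) (Ici 0) := by
  intro v hv w _ hvw
  have hw : 0 < w := lt_of_le_of_lt hv hvw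
  rcases (mem_Ici.1 hv).eq_or_lt with rfl | hv0
  · simpa [rectFlow] using h.rectFlow_pos hw z
  · simp only [h.rectFlow_of_pos hv0, h.rectFlow_of_pos hw]
    exact h.strictMono_inv (by linarith [h.strictMonoOn hv0 hw hvw])

lemma continuousOn_rectFlow (h : IsRectification α F E) :
    ContinuousOn (fun q : ℝ × ℝ => rectFlow F E q.1 q.2) (Ici 0 ×ˢ univ) := by
  rintro ⟨v, z⟩ ⟨hv, -⟩
  rcases (mem_Ici.1 hv).eq_or_lt with rfl | hv0
  · have h0 : rectFlow F E 0 z = 0 := by simp [rectFlow]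
    change Tendsto _ _ (𝓝 (rectFlow F E 0 z))
    rw [h0]
    refine tendsto_order.2 ⟨fun a ha => Eventually.of_forall fun q =>
      ha.trans_le (h.rectFlow_nonneg _ _), fun ε hε => ?_⟩
    -- On this neighbourhood `F q.1 < F ε - z - 1` (for `q.1 > 0`) and `q.2 < z + 1`, so the flow
    -- stays below `E (F ε) = ε`.
    have hU : Iio (E (F ε - z - 1)) ×ˢ Iio (z + 1) ∈ 𝓝 ((0 : ℝ), z) :=
      prod_mem_nhds (Iio_mem_nhds (h.inv_pos _)) (Iio_mem_nhds (by linarith))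
    filter_upwards [nhdsWithin_le_nhds hU] with q hq
    rcases le_or_gt q.1 0 with hq0 | hq0
    · simpa [rectFlow, hq0] using hε
    · rw [h.rectFlow_of_pos hq0, ← h.left_inv ε hε]
      apply h.strictMono_inv
      have h1 := h.strictMonoOn hq0 (h.inv_pos _) (mem_Iio.1 hq.1)
      rw [h.right_inv] at h1
      have h2 := mem_Iio.1 hq.2
      linarith
  · have hev : (fun q : ℝ × ℝ => rectFlow F E q.1 q.2) =ᶠ[𝓝 (v, z)]
        fun q => E (F q.1 + q.2) := by
      filter_upwards [prod_mem_nhds (Ioi_mem_nhds hv0) (univ_mem (f := 𝓝 z))] with q hq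
      exact h.rectFlow_of_pos hq.1 _
    have hF : ContinuousAt (fun q : ℝ × ℝ => F q.1) (v, z) :=
      ContinuousAt.comp (f := Prod.fst) (h.hasDerivAt v hv0).continuousAt continuousAt_fst
    have : ContinuousAt (fun q : ℝ × ℝ => E (F q.1 + q.2)) (v, z) :=
      h.continuous_inv.continuousAt.comp (hF.add continuousAt_snd)
    exact (this.congr hev.symm).continuousWithinAt

lemma classK_rectFlow (h : IsRectification α F E) (z : ℝ) :
    ClassK (fun v => rectFlow F E v z) where
  continuousOn := h.continuousOn_rectFlow.comp (f := fun v => (v, z)) (by fun_prop)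
    fun _ hv => ⟨hv, mem_univ _⟩
  nonneg v _ := h.rectFlow_nonneg v z
  map_zero := by simp [rectFlow]
  strictMonoOn := h.strictMonoOn_rectFlow z

lemma classKInf_rectFlow (h : IsRectification α F E) (z : ℝ) :
    ClassKInf (fun v => rectFlow F E v z) where
  toClassK := h.classK_rectFlow z
  unbounded M := by
    have hM : 0 < max M 0 + 1 := by positivity
    refine ⟨E (F (max M 0 + 1) - z), (h.inv_pos _).le, ?_⟩
    rw [h.rectFlow_of_pos (h.inv_pos _), h.right_inv, sub_add_cancel, h.left_inv _ hM]
    linarith [le_max_left M 0]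

lemma tendsto_inv_atBot (h : IsRectification α F E) : Tendsto E atBot (𝓝 0) := by
  refine tendsto_order.2 ⟨fun a ha => Eventually.of_forall fun z => ha.trans (h.inv_pos z),
    fun ε hε => ?_⟩
  filter_upwards [eventually_lt_atBot (F ε)] with z hz
  rw [← h.left_inv ε hε]
  exact h.strictMono_inv hz

lemma classKL (h : IsRectification α F E) {η φ : ℝ → ℝ} (hη : ClassK η) (hφ : ClassK φ)
    (C : ℝ) {c : ℝ} (hc : 0 < c) :
    ClassKL (fun r t => η (rectFlow F E (φ r) (C - c * t))) where
  continuousOn := by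
    refine hη.continuousOn.comp (h.continuousOn_rectFlow.comp
      (f := fun q : ℝ × ℝ => (φ q.1, C - c * q.2)) ?_ fun q hq => ⟨hφ.nonneg _ hq.1, mem_univ _⟩)
      fun q _ => h.rectFlow_nonneg _ _
    exact (hφ.continuousOn.comp continuousOn_fst fun q hq => hq.1).prodMk (by fun_prop)
  classK t _ := hη.comp ((h.classK_rectFlow _).comp hφ)
  strictAnti r hr s t _ hst hpos := by
    -- Positivity of the value excludes the equilibrium `0`, where the flow is constant in time.
    have hr0 : 0 < φ r := by
      by_contra hcon
      simp [rectFlow, not_lt.1 hcon, hη.map_zero] at hpos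
    refine hη.strictMonoOn (h.rectFlow_nonneg _ _) (h.rectFlow_nonneg _ _) ?_
    rw [h.rectFlow_of_pos hr0, h.rectFlow_of_pos hr0]
    apply h.strictMono_inv
    have := mul_lt_mul_of_pos_left hst hc
    linarith
  tendsto_zero r _ := by
    have h0 : Tendsto (fun t => rectFlow F E (φ r) (C - c * t)) atTop (𝓝 0) := by
      rcases le_or_gt (φ r) 0 with hr0 | hr0
      · simp [rectFlow, hr0]
      · simp only [h.rectFlow_of_pos hr0]
        refine h.tendsto_inv_atBot.comp (tendsto_atBot_add_const_left _ _ ?_)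
        simp only [sub_eq_add_neg]
        refine tendsto_atBot_add_const_left _ _ (tendsto_neg_atTop_atBot.comp ?_)
        exact tendsto_id.const_mul_atTop hc
    have h1 : Tendsto η (𝓝[Ici 0] 0) (𝓝 0) := by
      simpa [hη.map_zero] using (hη.continuousOn 0 self_mem_Ici).tendsto
    exact h1.comp (tendsto_nhdsWithin_of_tendsto_nhds_of_eventually_within _ h0
      (Eventually.of_forall fun t => h.rectFlow_nonneg _ _))

end IsRectification

/-! ### Impulse counts and the dwell-time estimate -/

lemma finite_inter_Ioc {γ : Set ℝ} (hγ : γ ∈ ImpulseTimes) (a b : ℝ) : (γ ∩ Ioc a b).Finite :=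
  (hγ.2 b).subset (inter_subset_inter_right γ Ioc_subset_Iic_self)

lemma numImpulses_add {γ : Set ℝ} (hγ : γ ∈ ImpulseTimes) {a b c : ℝ} (hab : a ≤ b) (hbc : b ≤ c) :
    numImpulses γ a b + numImpulses γ b c = numImpulses γ a c := by
  unfold numImpulses
  rw [← Ioc_union_Ioc_eq_Ioc hab hbc, inter_union_distrib_left,
    ncard_union_eq _ (finite_inter_Ioc hγ a b) (finite_inter_Ioc hγ b c)]
  exact (Ioc_disjoint_Ioc_of_le le_rfl).mono inter_subset_right inter_subset_right

lemma numImpulses_eq_zero_iff {γ : Set ℝ} (hγ : γ ∈ ImpulseTimes) {a b : ℝ} :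
    numImpulses γ a b = 0 ↔ γ ∩ Ioc a b = ∅ :=
  ncard_eq_zero (finite_inter_Ioc hγ a b)

lemma intervalIntegrable_of_locallyIntegrableOn {p : ℝ → ℝ} (hp : LocallyIntegrableOn p (Ici 0))
    {a b : ℝ} (ha : 0 ≤ a) (hb : 0 ≤ b) : IntervalIntegrable p volume a b :=
  (hp.integrableOn_compact_subset (fun _ hs => (le_min ha hb).trans hs.1)
    isCompact_uIcc).intervalIntegrable

/-- Cover the interval by `⌈(t - s) / θ⌉` windows of length `θ`; rounding up costs the extra `1`. -/
lemma integral_le_of_integral_window_le {p : ℝ → ℝ} (hp : LocallyIntegrableOn p (Ici 0))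
    (hp0 : ∀ t, 0 ≤ t → 0 ≤ p t) {θ P : ℝ} (hθ : 0 < θ)
    (hP : ∀ t, 0 ≤ t → ∫ s in t..t + θ, p s ≤ P) {s t : ℝ} (hs : 0 ≤ s) (hst : s ≤ t) :
    ∫ r in s..t, p r ≤ ((t - s) / θ + 1) * P := by
  have hP0 : 0 ≤ P := (intervalIntegral.integral_nonneg (by linarith) fun r hr =>
    hp0 r hr.1).trans (hP 0 le_rfl)
  have hk : ∀ k : ℕ, ∫ r in s..s + k * θ, p r ≤ k * P := by
    intro k
    induction k with
    | zero => simp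
    | succ k ih =>
      have h0 : 0 ≤ s + k * θ := by positivity
      have h1 : s + ((k + 1 : ℕ) : ℝ) * θ = s + k * θ + θ := by push_cast; ring
      rw [h1, ← intervalIntegral.integral_add_adjacent_intervals
        (intervalIntegrable_of_locallyIntegrableOn hp hs h0)
        (intervalIntegrable_of_locallyIntegrableOn hp h0 (by positivity))]
      have := hP _ h0
      push_cast
      linarith
  have hd : 0 ≤ (t - s) / θ := div_nonneg (by linarith) hθ.le
  have h1 : t ≤ s + ⌈(t - s) / θ⌉₊ * θ := by
    have := (div_le_iff₀ hθ).1 (Nat.le_ceil ((t - s) / θ))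
    linarith
  have h2 : ∫ r in s..t, p r ≤ ∫ r in s..s + ⌈(t - s) / θ⌉₊ * θ, p r := by
    rw [← intervalIntegral.integral_add_adjacent_intervals
      (intervalIntegrable_of_locallyIntegrableOn hp hs (hs.trans hst))
      (intervalIntegrable_of_locallyIntegrableOn hp (hs.trans hst)
        (hs.trans (hst.trans h1)))]
    have := intervalIntegral.integral_nonneg (μ := volume) h1 fun r hr =>
      hp0 r ((hs.trans hst).trans hr.1)
    linarith
  exact h2.trans ((hk _).trans (mul_le_mul_of_nonneg_right (Nat.ceil_lt_add_one hd).le hP0))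

/-- If every impulse decreases a quantity by `M` and the flow increases it at the rate `p`, with
`p` integrating to less than `M` over windows of length `θ`, then over a uniform subset of the
sequences with impulse frequency at least `1 / θ` the quantity decreases at a uniform linear
rate. -/
lemma IsUniformSubset.exists_linear_decay {S : Set (Set ℝ)} {θ : ℝ}
    (hS : IsUniformSubset S (1 / θ)) (hθ : 0 < θ)
    {p : ℝ → ℝ} (hp : LocallyIntegrableOn p (Ici 0)) (hp0 : ∀ t, 0 ≤ t → 0 ≤ p t)
    {P M : ℝ} (hP : ∀ t, 0 ≤ t → ∫ s in t..t + θ, p s ≤ P) (hPM : P < M) :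
    ∃ C c : ℝ, 0 < c ∧ ∀ γ ∈ S, ∀ s t, 0 ≤ s → s ≤ t →
      (∫ r in s..t, p r) - M * numImpulses γ s t ≤ C - c * (t - s + numImpulses γ s t) := by
  have hP0 : 0 ≤ P := (intervalIntegral.integral_nonneg (by linarith) fun r hr =>
    hp0 r hr.1).trans (hP 0 le_rfl)
  have hM : 0 < M := hP0.trans_lt hPM
  set ν : ℝ := 1 / θ with hν
  have hν0 : 0 < ν := one_div_pos.2 hθ
  set δ : ℝ := M - P with hδ
  have hδ0 : 0 < δ := sub_pos.2 hPM
  -- The margin per unit time is `δ ν`. Half of it pays for the frequency loss `ε = δ ν / (2 M)`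
  -- below, since `M ε = δ ν / 2`; the other half is `c (1 + ν)`, the decay in time and in impulse
  -- count.
  set c : ℝ := δ * ν / (2 * (1 + ν)) with hc
  have hc0 : 0 < c := by positivity
  have hc1 : c * (1 + ν) = δ * ν / 2 := by rw [hc]; field_simp
  have hcM : c ≤ M := by nlinarith
  obtain ⟨T, hT, hn⟩ := hS.2 (δ * ν / (2 * M)) (by positivity)
  -- On intervals shorter than `T` no frequency bound is available: this constant absorbs the flow,
  -- and impulses only help because `c ≤ M`. On longer intervals only the summand `P` from rounding
  -- is needed.
  refine ⟨P * (ν * T + 1) + c * T, c, hc0, fun γ hγ s t hs hst => ?_⟩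
  have hint := integral_le_of_integral_window_le hp hp0 hθ hP hs hst
  rw [div_eq_mul_one_div, ← hν] at hint
  have hN : (0 : ℝ) ≤ numImpulses γ s t := Nat.cast_nonneg _
  rcases le_or_gt T (t - s) with hL | hL
  · have h1 := hn γ hγ (t - s) hL s hs
    rw [add_sub_cancel, le_div_iff₀ (hT.trans_le hL)] at h1
    have hε : M * (δ * ν / (2 * M)) = δ * ν / 2 := by field_simp
    have h2 := mul_le_mul_of_nonneg_left h1 (sub_nonneg.2 hcM)
    have h3 : 0 ≤ c * (δ * ν / (2 * M)) := by positivity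
    have h4 : P * ν + c ≤ (M - c) * (ν - δ * ν / (2 * M)) := by nlinarith
    have h5 := mul_le_mul_of_nonneg_right h4 (hT.le.trans hL)
    have h6 : 0 ≤ P * (ν * T) := by positivity
    nlinarith
  · have h1 : P * ν * (t - s) ≤ P * ν * T := mul_le_mul_of_nonneg_left hL.le (by positivity)
    have h2 : c * (t - s) ≤ c * T := mul_le_mul_of_nonneg_left hL.le hc0.le
    have h3 := mul_nonneg (sub_nonneg.2 hcM) hN
    nlinarith

/-! ### Absolute continuity of compositions -/

lemma _root_.LipschitzOnWith.comp_absolutelyContinuousOnInterval {X Y : Type*}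
    [PseudoMetricSpace X] [PseudoMetricSpace Y] {G : X → Y} {K : NNReal} {s : Set X}
    (hG : LipschitzOnWith K G s) {x : ℝ → X} {a b : ℝ}
    (hx : AbsolutelyContinuousOnInterval x a b) (hs : MapsTo x (uIcc a b) s) :
    AbsolutelyContinuousOnInterval (fun t => G (x t)) a b := by
  unfold AbsolutelyContinuousOnInterval at hx ⊢
  refine squeeze_zero' (Eventually.of_forall fun E => Finset.sum_nonneg fun i _ => dist_nonneg) ?_
    (by simpa using hx.const_mul (K : ℝ))
  rw [eventually_inf_principal]
  refine Eventually.of_forall fun E hE => ?_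
  rw [Finset.mul_sum]
  exact Finset.sum_le_sum fun i hi => hG.dist_le_mul _ (hs (hE.1 i hi).1) _ (hs (hE.1 i hi).2)

lemma _root_.AbsolutelyContinuousOnInterval.prodMk {X Y : Type*}
    [PseudoMetricSpace X] [PseudoMetricSpace Y] {x : ℝ → X} {y : ℝ → Y} {a b : ℝ}
    (hx : AbsolutelyContinuousOnInterval x a b) (hy : AbsolutelyContinuousOnInterval y a b) :
    AbsolutelyContinuousOnInterval (fun t => (x t, y t)) a b := by
  unfold AbsolutelyContinuousOnInterval at hx hy ⊢
  have hxy := hx.add hy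
  rw [add_zero] at hxy
  refine squeeze_zero (fun E => Finset.sum_nonneg fun i _ => dist_nonneg) (fun E => ?_) hxy
  rw [← Finset.sum_add_distrib]
  refine Finset.sum_le_sum fun i _ => ?_
  rw [Prod.dist_eq]
  exact max_le_add_of_nonneg dist_nonneg dist_nonneg

/-- The graph of `x` over a compact interval is compact, so `V` has a single Lipschitz constant on
it. -/
lemma absolutelyContinuousOnInterval_along {X : Type*} [SeminormedAddCommGroup X] {V : ℝ → X → ℝ}
    (hV : LocallyLipschitzOn (Ici 0 ×ˢ univ) (fun q : ℝ × X => V q.1 q.2)) {x : ℝ → X} {a b : ℝ}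
    (ha : 0 ≤ a) (hb : 0 ≤ b) (hx : AbsolutelyContinuousOnInterval x a b) :
    AbsolutelyContinuousOnInterval (fun t => V t (x t)) a b := by
  have hid : AbsolutelyContinuousOnInterval (fun t : ℝ => t) a b :=
    (LipschitzWith.id.lipschitzOnWith (s := uIcc a b)).absolutelyContinuousOnInterval
  have hgr := hid.prodMk hx
  have hsub : (fun t => (t, x t)) '' uIcc a b ⊆ Ici 0 ×ˢ univ := by
    rintro _ ⟨t, ht, rfl⟩
    exact mk_mem_prod (mem_Ici.2 ((le_min ha hb).trans ht.1)) (mem_univ _)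
  have hcomp : IsCompact ((fun t => (t, x t)) '' uIcc a b) :=
    isCompact_uIcc.image_of_continuousOn (continuousOn_id.prodMk hx.continuousOn)
  obtain ⟨K, hK⟩ := LocallyLipschitzOn.exists_lipschitzOnWith_of_compact hcomp (hV.mono hsub)
  have hmaps : MapsTo (fun t => (t, x t)) (uIcc a b) ((fun t => (t, x t)) '' uIcc a b) :=
    mapsTo_image _ _
  have h := LipschitzOnWith.comp_absolutelyContinuousOnInterval
    (G := fun q : ℝ × X => V q.1 q.2) (x := fun t => (t, x t)) hK hgr hmaps
  exact h

/-! ### Growth of the Lyapunov function between impulses -/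

/-- Replacing the trajectory by its tangent line moves the argument of `V` by `o(s)`, hence the
difference quotient by `o(1)` since `V` is locally Lipschitz. The Dini hypothesis thus controls the
ordinary derivative along solutions wherever it exists. -/
lemma diniDeriv_eq_of_hasDerivAt {n m : ℕ}
    {f : ℝ → EuclideanSpace ℝ (Fin n) → EuclideanSpace ℝ (Fin m) → EuclideanSpace ℝ (Fin n)}
    {V : ℝ → EuclideanSpace ℝ (Fin n) → ℝ}
    (hV : LocallyLipschitzOn (Ici 0 ×ˢ univ) (fun q : ℝ × EuclideanSpace ℝ (Fin n) => V q.1 q.2))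
    {x : ℝ → EuclideanSpace ℝ (Fin n)} {t v' : ℝ} (ht : 0 ≤ t) {μ : EuclideanSpace ℝ (Fin m)}
    (hx : HasDerivAt x (f t (x t) μ) t) (hv : HasDerivAt (fun s => V s (x s)) v' t) :
    diniDeriv f V t (x t) μ = (v' : EReal) := by
  set w := f t (x t) μ with hw
  obtain ⟨K, U, hU, hK⟩ := hV (x := (t, x t)) ⟨ht, mem_univ _⟩
  have hle : 𝓝[>] (0 : ℝ) ≤ 𝓝[≠] 0 := nhdsWithin_mono _ fun s hs => (ne_of_gt hs)
  have hx0 := (hasDerivAt_iff_tendsto_slope_zero.1 hx).mono_left hle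
  have hv0 := (hasDerivAt_iff_tendsto_slope_zero.1 hv).mono_left hle
  have hadd : Tendsto (fun s : ℝ => t + s) (𝓝[>] 0) (𝓝 t) := by
    have : Continuous fun s : ℝ => t + s := by fun_prop
    exact (this.tendsto' 0 t (by simp)).mono_left nhdsWithin_le_nhds
  have hin : ∀ z : ℝ → EuclideanSpace ℝ (Fin n), Tendsto z (𝓝[>] 0) (𝓝 (x t)) →
      ∀ᶠ s in 𝓝[>] (0 : ℝ), (t + s, z s) ∈ U := by
    intro z hz
    refine (tendsto_nhdsWithin_of_tendsto_nhds_of_eventually_within _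
      (hadd.prodMk_nhds hz) ?_).eventually hU
    filter_upwards [self_mem_nhdsWithin] with s hs
    exact ⟨add_nonneg ht (le_of_lt hs), mem_univ _⟩
  have h1 := hin (fun s => x (t + s)) (hx.continuousAt.tendsto.comp hadd)
  have h2 := hin (fun s => x t + s • w) (by
    have : Continuous fun s : ℝ => x t + s • w := by fun_prop
    exact (this.tendsto' 0 (x t) (by simp)).mono_left nhdsWithin_le_nhds)
  have herr : Tendsto (fun s : ℝ => (V (t + s) (x t + s • w) - V (t + s) (x (t + s))) / s)
      (𝓝[>] 0) (𝓝 0) := by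
    have hb : Tendsto (fun s : ℝ => K * ‖s⁻¹ • (x (t + s) - x t) - w‖) (𝓝[>] 0) (𝓝 0) := by
      simpa using ((hx0.sub_const w).norm).const_mul (K : ℝ)
    refine squeeze_zero_norm' ?_ hb
    filter_upwards [h1, h2, self_mem_nhdsWithin] with s hs1 hs2 hs
    have hs : 0 < s := hs
    have hd := hK.dist_le_mul _ hs2 _ hs1
    rw [Prod.dist_eq, dist_self, max_eq_right dist_nonneg, dist_eq_norm, dist_eq_norm] at hd
    have he : x t + s • w - x (t + s) = -(s • (s⁻¹ • (x (t + s) - x t) - w)) := by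
      rw [smul_sub, smul_inv_smul₀ hs.ne']
      abel
    rw [he, norm_neg, norm_smul, Real.norm_of_nonneg hs.le] at hd
    rw [norm_div, Real.norm_of_nonneg hs.le, div_le_iff₀ hs]
    linarith
  have hsum : Tendsto (fun s : ℝ => (V (t + s) (x t + s • w) - V t (x t)) / s) (𝓝[>] 0)
      (𝓝 v') := by
    have := herr.add hv0
    rw [zero_add] at this
    refine this.congr fun s => ?_
    rw [smul_eq_mul]
    ring
  exact ((continuous_coe_real_ereal.tendsto v').comp hsum).limsup_eq

namespace IsRectification

variable {α F E : ℝ → ℝ}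

/-- The cutoff at `R` keeps the argument away from `0`, where `F' = 1 / α` may blow up. -/
lemma exists_lipschitzOnWith_max (h : IsRectification α F E) (hα : ClassP α) {R : ℝ} (hR : 0 < R)
    (B : ℝ) : ∃ K, LipschitzOnWith K (fun y => F (max y R)) (Iic B) := by
  have hsub : Icc R (max B R) ⊆ Ioi 0 := fun y hy => hR.trans_le hy.1
  have hc : ContinuousOn (fun s => 1 / α s) (Icc R (max B R)) :=
    continuousOn_const.div (hα.continuousOn.mono fun y hy => (mem_Ioi.1 (hsub hy)).le)
      fun s hs => (hα.pos s (hsub hs)).ne'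
  obtain ⟨D, hD⟩ := isCompact_Icc.exists_bound_of_continuousOn hc
  have hF : LipschitzOnWith D.toNNReal F (Icc R (max B R)) :=
    (convex_Icc _ _).lipschitzOnWith_of_nnnorm_hasDerivWithin_le
      (fun y hy => (h.hasDerivAt y (hsub hy)).hasDerivWithinAt) fun y hy => by
        rw [← NNReal.coe_le_coe, coe_nnnorm]
        exact (hD y hy).trans (Real.le_coe_toNNReal D)
  exact ⟨_, hF.comp ((LipschitzWith.id.max_const R).lipschitzOnWith (s := Iic B))
    fun y hy => ⟨le_max_right _ _, max_le_max_right R hy⟩⟩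

lemma continuous_max (h : IsRectification α F E) {R : ℝ} (hR : 0 < R) :
    Continuous fun y => F (max y R) :=
  ContinuousOn.comp_continuous (s := Ioi 0)
    (fun y hy => (h.hasDerivAt y hy).continuousAt.continuousWithinAt) (by fun_prop)
    fun y => hR.trans_le (le_max_right y R)

/-- Integration of the differential inequality `v' ≤ p α(v)`, required only where `v > R`. -/
lemma le_add_integral (h : IsRectification α F E) (hα : ClassP α) {R : ℝ} (hR : 0 < R)
    {v p : ℝ → ℝ} {a b : ℝ} (hab : a ≤ b) (hv : AbsolutelyContinuousOnInterval v a b)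
    (hp : IntervalIntegrable p volume a b) (hp0 : ∀ t ∈ Icc a b, 0 ≤ p t)
    (hdv : ∀ᵐ t, t ∈ Ioo a b → R < v t → ∀ v', HasDerivAt v v' t → v' ≤ p t * α (v t)) :
    F (max (v b) R) ≤ F (max (v a) R) + ∫ t in a..b, p t := by
  obtain ⟨B, hB⟩ := hv.exists_bound
  obtain ⟨K, hK⟩ := h.exists_lipschitzOnWith_max hα hR B
  have hac : AbsolutelyContinuousOnInterval (fun t => F (max (v t) R)) a b :=
    hK.comp_absolutelyContinuousOnInterval hv fun t ht => (le_abs_self _).trans (hB t ht)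
  have key : ∫ t in a..b, deriv (fun t => F (max (v t) R)) t ≤ ∫ t in a..b, p t := by
    refine intervalIntegral.integral_mono_ae_restrict hab hac.intervalIntegrable_deriv hp ?_
    have hIoo : ∀ᵐ t ∂volume.restrict (Icc a b), t ∈ Ioo a b := by
      rw [← restrict_Ioo_eq_restrict_Icc]
      exact ae_restrict_mem measurableSet_Ioo
    filter_upwards [hIoo, ae_restrict_of_ae hdv, ae_restrict_of_ae hv.ae_differentiableAt]
      with t ht hdt hvt
    have htI : t ∈ Icc a b := Ioo_subset_Icc_self ht
    have hd := (hvt (by rwa [uIcc_of_le hab])).hasDerivAt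
    rcases le_or_gt (v t) R with hle | hlt
    -- Where `v t ≤ R` the cut-off function attains its global minimum `F R`, so its derivative
    -- vanishes and no differential inequality is required.
    · have hmin : IsLocalMin (fun t => F (max (v t) R)) t := Eventually.of_forall fun s => by
        simp only [max_eq_right hle]
        exact h.strictMonoOn.monotoneOn hR (hR.trans_le (le_max_right _ _)) (le_max_right _ _)
      rw [hmin.deriv_eq_zero]
      exact hp0 t htI
    · have hpos : 0 < v t := hR.trans hlt
      have hev : (fun t => F (max (v t) R)) =ᶠ[𝓝 t] fun t => F (v t) := by
        filter_upwards [hd.continuousAt.eventually (lt_mem_nhds hlt)] with s hs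
        rw [max_eq_left (le_of_lt hs)]
      have hF : HasDerivAt (fun t => F (v t)) (1 / α (v t) * deriv v t) t :=
        (h.hasDerivAt _ hpos).comp t hd
      rw [hev.deriv_eq, hF.deriv, one_div_mul_eq_div, div_le_iff₀ (hα.pos _ hpos)]
      exact hdt ht hlt _ hd
  rw [hac.integral_deriv_eq_sub] at key
  linarith

end IsRectification

/-! ### Propagation through impulses -/

/-- A function that grows at most at the rate `p` between impulses and at each impulse either
decreases by `M` or falls to at most `K` is dominated by its initial value, or by `K` at some
later time, plus the accumulated changes. -/
lemma impulsive_comparison {γ : Set ℝ} (hγ : γ ∈ ImpulseTimes) {W p : ℝ → ℝ} {M K t₀ t₁ : ℝ}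
    (ht₀ : 0 ≤ t₀) (hp : LocallyIntegrableOn p (Ici 0)) (hp0 : ∀ t, 0 ≤ t → 0 ≤ p t)
    (hflow : ∀ a b, t₀ ≤ a → a ≤ b → b ≤ t₁ → γ ∩ Ioc a b = ∅ → W b ≤ W a + ∫ r in a..b, p r)
    (hjump : ∀ τ ∈ γ, t₀ < τ → τ ≤ t₁ →
      ∃ ω, Tendsto W (𝓝[<] τ) (𝓝 ω) ∧ (W τ ≤ ω - M ∨ W τ ≤ K))
    {t : ℝ} (ht : t₀ ≤ t) (ht₁ : t ≤ t₁) :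
    W t ≤ W t₀ + ((∫ r in t₀..t, p r) - M * numImpulses γ t₀ t) ∨
      ∃ s ∈ Icc t₀ t, W t ≤ K + ((∫ r in s..t, p r) - M * numImpulses γ s t) := by
  have hint : ∀ a b c, t₀ ≤ a → a ≤ b → b ≤ c →
      (∫ r in a..b, p r) + ∫ r in b..c, p r = ∫ r in a..c, p r := fun a b c ha hab hbc =>
    intervalIntegral.integral_add_adjacent_intervals
      (intervalIntegrable_of_locallyIntegrableOn hp (by linarith) (by linarith))
      (intervalIntegrable_of_locallyIntegrableOn hp (by linarith) (by linarith))
  induction k : numImpulses γ t₀ t using Nat.strong_induction_on generalizing t with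
  | _ k ih =>
  subst k
  rcases eq_empty_or_nonempty (γ ∩ Ioc t₀ t) with hem | hne
  · left
    rw [(numImpulses_eq_zero_iff hγ).2 hem]
    simpa using hflow t₀ t le_rfl ht ht₁ hem
  obtain ⟨τ, ⟨hτγ, hτ₀, hτt⟩, hτmax⟩ := exists_max_image _ id (finite_inter_Ioc hγ t₀ t) hne
  -- With `τ` the last impulse, `a` is the impulse before it, or `t₀` if there is none. The
  -- induction hypothesis is applied at `a`, which has one impulse fewer behind it.
  have hfin : (insert t₀ (γ ∩ Ioo t₀ τ)).Finite :=
    ((finite_inter_Ioc hγ t₀ τ).subset (inter_subset_inter_right γ Ioo_subset_Ioc_self)).insert _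
  obtain ⟨a, ha, hamax⟩ := exists_max_image _ id hfin ⟨t₀, mem_insert _ _⟩
  have ht₀a : t₀ ≤ a := hamax t₀ (mem_insert _ _)
  have haτ : a < τ := by
    rcases ha with rfl | ha
    · exact hτ₀
    · exact ha.2.2
  have hgap : ∀ s ∈ γ, a < s → τ ≤ s := fun s hs has => by
    by_contra hlt
    exact (hamax s (mem_insert_of_mem _ ⟨hs, ht₀a.trans_lt has, not_le.1 hlt⟩)).not_gt has
  have hlast : γ ∩ Ioc τ t = ∅ := by
    rw [eq_empty_iff_forall_notMem]
    rintro s ⟨hs, hτs, hst⟩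
    exact (hτmax s ⟨hs, hτ₀.trans hτs, hst⟩).not_gt hτs
  have hone : numImpulses γ a τ = 1 := by
    have : γ ∩ Ioc a τ = {τ} := by
      ext s
      refine ⟨fun hs => le_antisymm hs.2.2 (hgap s hs.1 hs.2.1), ?_⟩
      rintro rfl
      exact ⟨hτγ, haτ, le_rfl⟩
    rw [numImpulses, this, ncard_singleton]
  have hcount : ∀ s, s ≤ a → numImpulses γ s t = numImpulses γ s a + 1 := fun s hs => by
    rw [← numImpulses_add hγ (hs.trans haτ.le) hτt, ← numImpulses_add hγ hs haτ.le, hone,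
      (numImpulses_eq_zero_iff hγ).2 hlast, add_zero]
  have hWt : W t ≤ W τ + ∫ r in τ..t, p r := hflow τ t hτ₀.le hτt ht₁ hlast
  obtain ⟨ω, hω, hτjump⟩ := hjump τ hτγ hτ₀ (hτt.trans ht₁)
  rcases hτjump with hdec | hK
  swap
  · right
    -- A fall to `K` at the last impulse forgets the past, so the comparison restarts at `τ`.
    refine ⟨τ, ⟨hτ₀.le, hτt⟩, ?_⟩
    rw [(numImpulses_eq_zero_iff hγ).2 hlast]
    simp only [Nat.cast_zero, mul_zero, sub_zero]
    linarith
  -- The flow estimate excludes an impulse at the right endpoint, so it is used up to `b < τ` and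
  -- passed to the left limit.
  have hωa : ω ≤ W a + ∫ r in a..τ, p r := by
    refine le_of_tendsto hω ?_
    filter_upwards [Ioo_mem_nhdsLT haτ] with b hb
    have h1 : γ ∩ Ioc a b = ∅ := by
      rw [eq_empty_iff_forall_notMem]
      rintro s ⟨hs, has, hsb⟩
      exact (hgap s hs has).not_gt (hsb.trans_lt hb.2)
    have h2 := hflow a b ht₀a hb.1.le (by linarith [hb.2]) h1
    have h3 := intervalIntegral.integral_nonneg (μ := volume) hb.2.le fun r hr =>
      hp0 r (by linarith [hr.1, hb.1])
    rw [← hint a b τ ht₀a hb.1.le hb.2.le]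
    linarith
  have hsum : ∀ s, t₀ ≤ s → s ≤ a → (∫ r in s..t, p r) =
      (∫ r in s..a, p r) + (∫ r in a..τ, p r) + ∫ r in τ..t, p r := fun s hs hsa => by
    rw [hint s a τ hs hsa haτ.le, hint s τ t hs (hsa.trans haτ.le) hτt]
  rcases ih (numImpulses γ t₀ a) (by rw [hcount t₀ ht₀a]; exact Nat.lt_succ_self _) ht₀a
    (by linarith) rfl with hA | ⟨s, hs, hA⟩
  · left
    rw [hcount t₀ ht₀a, hsum t₀ le_rfl ht₀a]
    push_cast
    linarith
  · right
    refine ⟨s, ⟨hs.1, by linarith [hs.2]⟩, ?_⟩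
    rw [hcount s hs.2, hsum s hs.1 hs.2]
    push_cast
    linarith

/-! ### Input norms -/

/-- Finiteness matters because `toReal` sends `⊤` to `0`, which would bound nothing. -/
lemma inputNorm_Ioc_ne_top {m : ℕ} {γ : Set ℝ} (hγ : γ ∈ ImpulseTimes)
    {u : ℝ → EuclideanSpace ℝ (Fin m)} (hu : u ∈ Inputs m) {a b : ℝ} (ha : 0 ≤ a) :
    inputNorm γ u (Ioc a b) ≠ ⊤ := by
  obtain ⟨C, hC⟩ := hu.2 b
  obtain ⟨D, hD⟩ := ((finite_inter_Ioc hγ a b).image fun t => ‖u t‖).bddAbove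
  have h1 : essSup (fun t => ‖u t‖ₑ) (volume.restrict (Ioc a b)) ≤ ENNReal.ofReal C := by
    refine essSup_le_of_ae_le _ ?_
    have hsub : Ioc a b ⊆ Icc 0 b := fun s hs => ⟨ha.trans hs.1.le, hs.2⟩
    filter_upwards [ae_mono (Measure.restrict_mono hsub le_rfl) hC] with s hs
    rw [← ofReal_norm]
    exact ENNReal.ofReal_le_ofReal hs
  have h2 : (⨆ t ∈ γ ∩ Ioc a b, ‖u t‖ₑ) ≤ ENNReal.ofReal D := iSup₂_le fun s hs => by
    rw [← ofReal_norm]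
    exact ENNReal.ofReal_le_ofReal (hD (mem_image_of_mem _ hs))
  exact ((max_le_max h1 h2).trans_lt (max_lt ENNReal.ofReal_lt_top ENNReal.ofReal_lt_top)).ne

lemma norm_le_toReal_inputNorm {m : ℕ} {γ : Set ℝ} {u : ℝ → EuclideanSpace ℝ (Fin m)} {I : Set ℝ}
    (hfin : inputNorm γ u I ≠ ⊤) {t : ℝ} (ht : t ∈ γ ∩ I) : ‖u t‖ ≤ (inputNorm γ u I).toReal := by
  rw [← toReal_enorm]
  exact ENNReal.toReal_mono hfin
    ((le_iSup₂ (f := fun s (_ : s ∈ γ ∩ I) => ‖u s‖ₑ) t ht).trans (le_max_right _ _))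

lemma ae_norm_le_toReal_inputNorm {m : ℕ} {γ : Set ℝ} {u : ℝ → EuclideanSpace ℝ (Fin m)}
    {I : Set ℝ} (hI : MeasurableSet I) (hfin : inputNorm γ u I ≠ ⊤) :
    ∀ᵐ t, t ∈ I → ‖u t‖ ≤ (inputNorm γ u I).toReal := by
  rw [← ae_restrict_iff' hI]
  filter_upwards [ae_le_essSup (f := fun t => ‖u t‖ₑ) (μ := volume.restrict I)] with t ht
  rw [← toReal_enorm]
  exact ENNReal.toReal_mono hfin (ht.trans (le_max_left _ _))

/-! ### The Lyapunov estimate along solutions -/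

section Solutions

variable {n m : ℕ}
  {f g : ℝ → EuclideanSpace ℝ (Fin n) → EuclideanSpace ℝ (Fin m) → EuclideanSpace ℝ (Fin n)}
  {V : ℝ → EuclideanSpace ℝ (Fin n) → ℝ} {p φ ψ χ π F E : ℝ → ℝ}
  {t₀ : ℝ} {x₀ : EuclideanSpace ℝ (Fin n)} {u : ℝ → EuclideanSpace ℝ (Fin m)} {γ : Set ℝ}
  {T : EReal} {x : ℝ → EuclideanSpace ℝ (Fin n)}

/-- Where `V > R ≥ χ N`, the bound `‖u‖ ≤ N` gives `V ≥ χ ‖u‖` almost everywhere, which is the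
regime of the decay condition. -/
lemma IsSolution.rectified_flow_le (hx : IsSolution f g t₀ x₀ u γ T x) (ht₀ : 0 ≤ t₀)
    (hV : LocallyLipschitzOn (Ici 0 ×ˢ univ) (fun q : ℝ × EuclideanSpace ℝ (Fin n) => V q.1 q.2))
    (hp : LocallyIntegrableOn p (Ici 0)) (hp0 : ∀ t, 0 ≤ t → 0 ≤ p t)
    (hφ : ClassP (fun s => -φ s)) (hF : IsRectification (fun s => -φ s) F E) (hχ : ClassK χ)
    (hdecay : ∀ t, 0 ≤ t → ∀ ξ μ, χ ‖μ‖ ≤ V t ξ →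
      diniDeriv f V t ξ μ ≤ ((-p t * φ (V t ξ) : ℝ) : EReal))
    {N R : ℝ} (hN : 0 ≤ N) (hR : 0 < R) (hχR : χ N ≤ R) {a b : ℝ} (ha : t₀ ≤ a) (hab : a ≤ b)
    (hb : (b : EReal) < T) (hγ : γ ∩ Ioc a b = ∅) (hu : ∀ᵐ t, t ∈ Ioc a b → ‖u t‖ ≤ N) :
    F (max (V b (x b)) R) ≤ F (max (V a (x a)) R) + ∫ t in a..b, p t := by
  have ha0 : 0 ≤ a := ht₀.trans ha
  refine hF.le_add_integral (v := fun t => V t (x t)) hφ hR hab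
    (absolutelyContinuousOnInterval_along hV ha0 (ha0.trans hab) (hx.absCont a b ha hab hb hγ))
    (intervalIntegrable_of_locallyIntegrableOn hp ha0 (ha0.trans hab))
    (fun t ht => hp0 t (ha0.trans ht.1)) ?_
  filter_upwards [hx.flow, hu] with t hflow hut ht hRt v' hv'
  have ht0 : 0 ≤ t := ha0.trans ht.1.le
  have hxt := hflow (ha.trans_lt ht.1) ((EReal.coe_lt_coe_iff.2 ht.2).trans hb)
  have hle : χ ‖u t‖ ≤ V t (x t) :=
    ((hχ.monotoneOn (norm_nonneg _) hN (hut (Ioo_subset_Ioc_self ht))).trans hχR).trans hRt.le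
  have := hdecay t ht0 (x t) (u t) hle
  rw [diniDeriv_eq_of_hasDerivAt hV ht0 hxt hv', EReal.coe_le_coe_iff] at this
  linarith

/-- If `V` exceeds `R ≥ π N` after the jump, the value before it cannot have been below `χ ‖u τ‖`,
so the `ψ` estimate applies; it also forces that value to be positive, since `ψ 0 = 0`. -/
lemma IsSolution.rectified_jump_le (hx : IsSolution f g t₀ x₀ u γ T x) (ht₀ : 0 ≤ t₀)
    (hV : LocallyLipschitzOn (Ici 0 ×ˢ univ) (fun q : ℝ × EuclideanSpace ℝ (Fin n) => V q.1 q.2))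
    (hV0 : ∀ t, 0 ≤ t → ∀ ξ, 0 ≤ V t ξ) {α : ℝ → ℝ} (hF : IsRectification α F E)
    (hψ : ClassP ψ) {M : ℝ} (hM : ∀ a, 0 < a → F (ψ a) ≤ F a - M) (hπ : ClassK π)
    (hdecay : ∀ t, 0 ≤ t → ∀ ξ μ, (χ ‖μ‖ ≤ V t ξ → V t (ξ + g t ξ μ) ≤ ψ (V t ξ)) ∧
      (V t ξ ≤ χ ‖μ‖ → V t (ξ + g t ξ μ) ≤ π ‖μ‖))
    {N R : ℝ} (hN : 0 ≤ N) (hR : 0 < R) (hπR : π N ≤ R) {τ : ℝ} (hτ : τ ∈ γ) (hτ₀ : t₀ < τ)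
    (hτT : (τ : EReal) < T) (hu : ‖u τ‖ ≤ N) :
    ∃ ω, Tendsto (fun t => F (max (V t (x t)) R)) (𝓝[<] τ) (𝓝 ω) ∧
      (F (max (V τ (x τ)) R) ≤ ω - M ∨ F (max (V τ (x τ)) R) ≤ F R) := by
  have hτ0 : 0 ≤ τ := ht₀.trans hτ₀.le
  obtain ⟨y, hy, hxτ⟩ := hx.jump τ hτ hτ₀ hτT
  have hid : Tendsto (fun t : ℝ => t) (𝓝[<] τ) (𝓝 τ) := nhdsWithin_le_nhds
  have hlim : Tendsto (fun t => V t (x t)) (𝓝[<] τ) (𝓝 (V τ y)) := by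
    refine (hV.continuousOn (τ, y) ⟨hτ0, mem_univ _⟩).tendsto.comp
      (tendsto_nhdsWithin_of_tendsto_nhds_of_eventually_within _ (hid.prodMk_nhds hy) ?_)
    filter_upwards [Ioo_mem_nhdsLT hτ₀] with t ht
    exact ⟨ht₀.trans ht.1.le, mem_univ _⟩
  refine ⟨_, ((hF.continuous_max hR).tendsto _).comp hlim, ?_⟩
  rcases le_or_gt (V τ (x τ)) R with hle | hlt
  · right
    rw [max_eq_right hle]
  left
  rw [max_eq_left hlt.le]
  obtain ⟨h1, h2⟩ := hdecay τ hτ0 y (u τ)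
  rw [← hxτ] at h1 h2
  have hψy : V τ (x τ) ≤ ψ (V τ y) := h1 <| by
    by_contra! hcon
    exact hlt.not_ge
      ((h2 hcon.le).trans ((hπ.monotoneOn (norm_nonneg _) hN hu).trans hπR))
  have hpos : 0 < V τ (x τ) := hR.trans hlt
  have hy0 : 0 < V τ y := by
    refine (hV0 τ hτ0 y).lt_of_ne fun h0 => ?_
    rw [← h0, hψ.map_zero] at hψy
    linarith
  have h3 := hF.strictMonoOn.monotoneOn hpos (hpos.trans_le hψy) hψy
  have h4 := hF.strictMonoOn.monotoneOn hy0 (hy0.trans_le (le_max_left _ R)) (le_max_left _ R)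
  linarith [hM _ hy0]

end Solutions

end ImpulsiveISS

open ImpulsiveISS in
theorem theorem2 (n m : ℕ)
    (f g : ℝ → EuclideanSpace ℝ (Fin n) → EuclideanSpace ℝ (Fin m) → EuclideanSpace ℝ (Fin n))
    (hf : ∀ u ∈ ImpulsiveISS.Inputs m, ImpulsiveISS.IsCaratheodory (fun t ξ => f t ξ (u t)))
    (hO h : ℝ → EuclideanSpace ℝ (Fin n) → ℝ)
    (hO_nonneg : ∀ t, 0 ≤ t → ∀ ξ, 0 ≤ hO t ξ)
    (h_nonneg : ∀ t, 0 ≤ t → ∀ ξ, 0 ≤ h t ξ)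
    (V : ℝ → EuclideanSpace ℝ (Fin n) → ℝ) (p φ ψ : ℝ → ℝ)
    (hV : ImpulsiveISS.IsLyapunovCandidate f g hO h V p φ ψ)
    (hψ : ImpulsiveISS.ClassP ψ)
    (hφ : ImpulsiveISS.ClassP (fun s => -φ s))
    (θ : ℝ) (hθ : 0 < θ)
    (hgap : (⨆ t : Set.Ici (0 : ℝ), ((∫ s in (t : ℝ)..(t : ℝ) + θ, p s : ℝ) : EReal)) <
      ⨅ a : Set.Ioi (0 : ℝ), ((∫ s in (ψ a)..(a : ℝ), 1 / (-φ s) : ℝ) : EReal))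
    (hdiv : ∫⁻ s in Set.Ioi (1 : ℝ), ENNReal.ofReal (1 / (-φ s)) = ⊤)
    (S : Set (Set ℝ)) (hS : ImpulsiveISS.IsUniformSubset S (1 / θ)) :
    ImpulsiveISS.StronglyISS f g hO h S := by
  have hp := hV.p_locallyIntegrable
  have hp0 := hV.p_nonneg
  -- Two real numbers `P < M` are inserted into the strict gap, leaving the margin `M - P` that
  -- produces the decay.
  obtain ⟨P, hsupP, hPinf⟩ := EReal.lt_iff_exists_real_btwn.1 hgap
  obtain ⟨M, hPM', hMinf⟩ := EReal.lt_iff_exists_real_btwn.1 hPinf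
  have hPM : P < M := EReal.coe_lt_coe_iff.1 hPM'
  have hP : ∀ t, 0 ≤ t → ∫ s in t..t + θ, p s ≤ P := fun t ht =>
    EReal.coe_le_coe_iff.1 ((le_iSup (fun t : Set.Ici (0 : ℝ) =>
      ((∫ s in (t : ℝ)..(t : ℝ) + θ, p s : ℝ) : EReal)) ⟨t, ht⟩).trans hsupP.le)
  have hM : ∀ a, 0 < a → M ≤ ∫ s in (ψ a)..a, 1 / (-φ s) := fun a ha =>
    EReal.coe_le_coe_iff.1 (hMinf.le.trans (iInf_le (fun a : Set.Ioi (0 : ℝ) =>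
      ((∫ s in (ψ a)..(a : ℝ), 1 / (-φ s) : ℝ) : EReal)) ⟨a, ha⟩))
  have hM0 : 0 < M := lt_of_le_of_lt ((intervalIntegral.integral_nonneg (by linarith)
    fun r hr => hp0 r hr.1).trans (hP 0 le_rfl)) hPM
  obtain ⟨F, E, hF⟩ := exists_isRectification hφ hψ.pos hM0 hM hdiv
  have hFM : ∀ a, 0 < a → F (ψ a) ≤ F a - M := fun a ha => by
    have := hM a ha
    rw [hF.integral_eq _ _ (hψ.pos a ha) ha] at this
    linarith
  obtain ⟨C, c, hc, hdec⟩ := hS.exists_linear_decay hθ hp hp0 hP hPM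
  obtain ⟨φ₁, φ₂, hφ₁, hφ₂, hsand⟩ := hV.sandwich
  obtain ⟨χ, π, hχ, hπ, hdecay⟩ := hV.decay
  obtain ⟨η, hη, hηφ⟩ := hφ₁.exists_inverse
  have hV0 : ∀ t, 0 ≤ t → ∀ ξ, 0 ≤ V t ξ := fun t ht ξ =>
    (hφ₁.nonneg _ (h_nonneg t ht ξ)).trans (hsand t ht ξ).1
  have hG : ClassKInf fun r => rectFlow F E (χ r + π r) C :=
    (hF.classKInf_rectFlow C).comp (hχ.add hπ)
  refine ⟨_, _, hF.classKL hη.toClassK hφ₂.toClassK C hc, hη.comp hG, ?_⟩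
  intro t₀ ht₀ x₀ u hu γ hγS T x hmax t ht htT
  have hx := hmax.1
  have hγ : γ ∈ ImpulseTimes := (hS.1 hγS).1
  have ht0 : 0 ≤ t := ht₀.trans ht
  set L : ℝ := t - t₀ + numImpulses γ t₀ t with hL
  set N : ℝ := (inputNorm γ u (Ioc t₀ t)).toReal with hN
  have hN0 : 0 ≤ N := ENNReal.toReal_nonneg
  have hfin := inputNorm_Ioc_ne_top (b := t) hγ hu ht₀
  have hae := ae_norm_le_toReal_inputNorm measurableSet_Ioc hfin
  -- The cutoff level must be positive for `F` to be usable, but `N` may be `0`; hence the estimate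
  -- is made for `r > N`, and `r` tends to `N` afterwards.
  have hbound : ∀ r, N < r →
      V t (x t) ≤ max (rectFlow F E (V t₀ x₀) (C - c * L)) (rectFlow F E (χ r + π r) C) := by
    intro r hr
    have hr0 : 0 < r := hN0.trans_lt hr
    have hR : 0 < χ r + π r := add_pos (hχ.pos hr0) (hπ.pos hr0)
    have hcomp := impulsive_comparison hγ (W := fun s => F (max (V s (x s)) (χ r + π r)))
      (M := M) (K := F (χ r + π r)) (t₁ := t) ht₀ hp hp0
      (fun a b ha hab hb hempty => hx.rectified_flow_le ht₀ hV.locallyLipschitz hp hp0 hφ hF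
        hχ.toClassK (fun t ht ξ μ => (hdecay t ht ξ μ).1) hr0.le hR
        (le_add_of_nonneg_right (hπ.pos hr0).le) ha hab
        ((EReal.coe_le_coe_iff.2 hb).trans_lt htT) hempty
        (by filter_upwards [hae] with s hs hsab
            exact (hs ⟨ha.trans_lt hsab.1, hsab.2.trans hb⟩).trans hr.le))
      (fun τ hτ hτ₀ hτt => hx.rectified_jump_le ht₀ hV.locallyLipschitz hV0 hF hψ hFM
        hπ.toClassK (fun t ht ξ μ => (hdecay t ht ξ μ).2) hr0.le hR
        (le_add_of_nonneg_left (hχ.pos hr0).le) hτ hτ₀ ((EReal.coe_le_coe_iff.2 hτt).trans_lt htT)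
        ((norm_le_toReal_inputNorm hfin ⟨hτ, hτ₀, hτt⟩).trans hr.le))
      ht le_rfl
    have hLnn : ∀ s, s ≤ t → 0 ≤ c * (t - s + numImpulses γ s t) := fun s hs =>
      mul_nonneg hc.le (add_nonneg (sub_nonneg.2 hs) (Nat.cast_nonneg _))
    have hlow : ∀ z, F (max (V t (x t)) (χ r + π r)) ≤ z → V t (x t) ≤ E z := fun z hz =>
      (le_max_left _ _).trans (hF.le_inv_of_le (hR.trans_le (le_max_right _ _)) hz)
    rcases hcomp with hA | ⟨s, hs, hA⟩
    · have hd := hdec γ hγS t₀ t ht₀ ht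
      -- An initial value below the cutoff contributes only the floor, so it is charged to the gain
      -- term with the decay discarded; one above it gives the `KL` term.
      rcases le_or_gt (V t₀ x₀) (χ r + π r) with hle | hlt
      · refine le_max_of_le_right ?_
        rw [hF.rectFlow_of_pos hR]
        simp only [hx.init, max_eq_right hle] at hA
        exact hlow _ (by linarith [hLnn t₀ ht])
      · refine le_max_of_le_left ?_
        rw [hF.rectFlow_of_pos (hR.trans hlt)]
        simp only [hx.init, max_eq_left hlt.le] at hA
        exact hlow _ (by linarith)
    · refine le_max_of_le_right ?_
      rw [hF.rectFlow_of_pos hR]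
      exact hlow _ (by linarith [hdec γ hγS s t (ht₀.trans hs.1) hs.2, hLnn s hs.2])
  have hVt : V t (x t) ≤
      max (rectFlow F E (V t₀ x₀) (C - c * L)) (rectFlow F E (χ N + π N) C) := by
    have hlim : Tendsto (fun r => rectFlow F E (χ r + π r) C) (𝓝[>] N)
        (𝓝 (rectFlow F E (χ N + π N) C)) :=
      ((hG.continuousOn N hN0).mono fun r hr => hN0.trans (le_of_lt hr)).tendsto
    exact ge_of_tendsto (tendsto_const_nhds.max hlim) (eventually_nhdsWithin_of_forall hbound)
  have hA : rectFlow F E (V t₀ x₀) (C - c * L) ≤ rectFlow F E (φ₂ (hO t₀ x₀)) (C - c * L) :=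
    (hF.strictMonoOn_rectFlow _).monotoneOn (hV0 t₀ ht₀ x₀)
      (hφ₂.nonneg _ (hO_nonneg t₀ ht₀ x₀)) (hsand t₀ ht₀ x₀).2
  have hA0 := hF.rectFlow_nonneg (φ₂ (hO t₀ x₀)) (C - c * L)
  have hG0 := hF.rectFlow_nonneg (χ N + π N) C
  have hηmax : η (max (rectFlow F E (φ₂ (hO t₀ x₀)) (C - c * L)) (rectFlow F E (χ N + π N) C)) ≤
      η (rectFlow F E (φ₂ (hO t₀ x₀)) (C - c * L)) + η (rectFlow F E (χ N + π N) C) := by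
    rw [hη.monotoneOn.map_max hA0 hG0]
    exact max_le_add_of_nonneg (hη.nonneg _ hA0) (hη.nonneg _ hG0)
  calc h t (x t) = η (φ₁ (h t (x t))) := (hηφ _ (h_nonneg t ht0 _)).symm
    _ ≤ η (max (rectFlow F E (φ₂ (hO t₀ x₀)) (C - c * L)) (rectFlow F E (χ N + π N) C)) :=
      hη.monotoneOn (hφ₁.nonneg _ (h_nonneg t ht0 _)) (hA0.trans (le_max_left _ _))
        ((hsand t ht0 _).1.trans (hVt.trans (max_le_max_right _ hA)))
    _ ≤ _ := hηmax
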